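/- Let $\mathbf C_2$ be the two-dimensional comb, i.e. the graph on $\mathbb Z^2$ obtained from the square lattice by removing all horizontal edges off the $x$-axis. Let $S_n=(S_n^x,S_n^y)$, $n\ge 0$, be the simple random walk on $\mathbf C_2$ started at $(0,0)$ (at each step the walker moves to a uniformly chosen neighbour), and let $D_n^y:=\max\{|S_i^y| : 0\le i\le n\}$ be its maximal vertical deviation in $n$ steps. Then $D_n^y$ is integrable and $$\mathbb E[D_n^y]\sim\sqrt{\frac{\pi}{2}}\;n^{1/2}\qquad (n\to\infty).$$ Moreover, if $z,v\in\mathbb C$ satisfy $|z|<1$, $1+v^2\ne0$ and $\dfrac{v}{1+v^2}=\dfrac z2$, then both series below converge and $$\sum_{n\ge0}\mathbb E[D_n^y]\,z^n=\frac{(1+v^2)(1+v)}{(1-v)^2}\sum_{h\ge1}\frac{v^h}{1+v^{2h+1}}.$$ Finally, for $i\ge0$ let $a_i(z/2)$ be the determinant of the $(i+1)\times(i+1)$ tridiagonal matrix with $1$ on the diagonal and $-z/2$ on the two adjacent diagonals. If $z,v\in\mathbb C$ satisfy $v/(1+v^2)=z/2$, $1+v^2\neq0$ and $v^2\ne1$,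 then $$a_i(z/2)=\frac{1-v^{2i+4}}{(1-v^2)(1+v^2)^{i+1}}.$$ -/

import Mathlib

open MeasureTheory Filter Asymptotics

/-- The one-step transition probabilities of the simple random walk on a locally finite graph:
`1 / deg x` from `x` to each of its neighbours, and `0` otherwise. -/
noncomputable def srwProb {V : Type*} (G : SimpleGraph V) (x y : V) : ℝ :=
  open Classical in if G.Adj x y then 1 / ((G.neighborSet x).ncard : ℝ) else 0

/-- The process `S` is, under `μ`, the simple random walk on `G` started at `o`: conditionally on
`S 0 = x 0, …, S n = x n`, the next position is `y` with probability `srwProb G (x n) y`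
(written in product form, so that no conditioning on a null event occurs). -/
structure IsSimpleRandomWalk {V : Type*} [MeasurableSpace V] (G : SimpleGraph V) (o : V)
    {Ω : Type*} [MeasurableSpace Ω] (μ : Measure Ω) (S : ℕ → Ω → V) : Prop where
  measurable : ∀ n, Measurable (S n)
  start : ∀ᵐ ω ∂μ, S 0 ω = o
  step : ∀ (n : ℕ) (x : ℕ → V) (y : V),
    μ.real {ω | (∀ i ≤ n, S i ω = x i) ∧ S (n + 1) ω = y} =
      μ.real {ω | ∀ i ≤ n, S i ω = x i} * srwProb G (x n) y

/-- The two-dimensional comb: the graph obtained from the square lattice `ℤ × ℤ` by removing all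
horizontal edges off the `x`-axis. -/
def combGraph : SimpleGraph (ℤ × ℤ) where
  Adj a b := (a.1 = b.1 ∧ |a.2 - b.2| = 1) ∨ (a.2 = 0 ∧ b.2 = 0 ∧ |a.1 - b.1| = 1)
  symm := ⟨by
    rintro a b (⟨h, h'⟩ | ⟨h, h', h''⟩)
    · exact Or.inl ⟨h.symm, by rwa [abs_sub_comm]⟩
    · exact Or.inr ⟨h', h, by rwa [abs_sub_comm]⟩⟩
  loopless := ⟨by
    rintro a (⟨_, h⟩ | ⟨_, _, h⟩) <;> simp at h⟩

/-- The maximal vertical deviation `max {|S_i^y| : 0 ≤ i ≤ n}` of the walk in `n` steps. -/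
def maxVerticalDeviation {Ω : Type*} (S : ℕ → Ω → ℤ × ℤ) (n : ℕ) (ω : Ω) : ℕ :=
  (Finset.range (n + 1)).sup fun i => (S i ω).2.natAbs

/-- The `(i + 1) × (i + 1)` tridiagonal matrix with `1` on the diagonal and `-w` on the two
adjacent diagonals. -/
def tridiagMatrix (i : ℕ) (w : ℂ) : Matrix (Fin (i + 1)) (Fin (i + 1)) ℂ :=
  Matrix.of fun j k =>
    if j = k then 1 else if (j : ℕ) + 1 = k ∨ (k : ℕ) + 1 = j then -w else 0

/-! The height `|S^y|` is a Markov chain: a simple random walk on ℤ folded at `-1/2`, since at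
height 0 half of the mass stays at 0. So `D_n < h` has the probability that a walk on ℤ from 0 stays
in `[-h, h-1]`. By the method of images this is `(u_n(0) + u_n(1))/2`, where `u_n` is the heat
evolution of an even square wave of half-period `2h+1`
(`measure_maxVerticalDeviation_lt_eq_survival`).

Asymptotics: summing `1 - squareWave h w` over `h ≥ 1` and exchanging sums gives twice an
alternating sum of floors, which by Leibniz's series is `π/4 · w + o(w)`. Since `u_n(1) =
u_{n+1}(0)`, the mean deviation is the mean of this floor sum at times `n` and `n+1`, hence about
`π/2 · E|W_n|`; and `E|W_n| ~ √(2n/π)` by a discrete Tanaka formula and Wallis's product.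

Generating function: for fixed `h` the survival probabilities satisfy a linear boundary value
problem whose homogeneous solutions are powers of `v`; the sums over `h` and `n` are exchanged by
absolute convergence. The determinant obeys a second-order recurrence and is independent of the
rest. -/

/-! ### The height process and its killed evolution -/

/-- The Markov property of a simple random walk, integrated against a functional of the past. -/
theorem IsSimpleRandomWalk.lintegral_past_mul {V : Type*} [MeasurableSpace V] [Countable V]
    [MeasurableSingletonClass V] {G : SimpleGraph V} {o : V} {Ω : Type*} [MeasurableSpace Ω]
    {μ : Measure Ω} [IsFiniteMeasure μ] {S : ℕ → Ω → V} (hS : IsSimpleRandomWalk G o μ S) (n : ℕ)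
    (F : (Fin (n + 1) → V) → ENNReal) (g : V → ENNReal) :
    ∫⁻ ω, F (fun i => S i ω) * g (S (n + 1) ω) ∂μ =
      ∫⁻ ω, F (fun i => S i ω) * ∑' y, ENNReal.ofReal (srwProb G (S n ω) y) * g y ∂μ := by
  have hT : Measurable fun ω => (fun i : Fin (n + 1) => S i ω) :=
    measurable_pi_lambda _ fun i => hS.measurable i
  have hTS : Measurable fun ω => ((fun i : Fin (n + 1) => S i ω), S (n + 1) ω) :=
    hT.prodMk (hS.measurable _)
  have hl := lintegral_map (μ := μ)
    (f := fun p : (Fin (n + 1) → V) × V => F p.1 * g p.2) (measurable_of_countable _) hTS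
  have hr := lintegral_map (μ := μ)
    (f := fun p : Fin (n + 1) → V =>
      F p * ∑' y, ENNReal.ofReal (srwProb G (p (Fin.last n)) y) * g y)
    (measurable_of_countable _) hT
  simp only [Fin.val_last] at hl hr
  rw [← hl, ← hr, lintegral_countable', lintegral_countable', ENNReal.summable.tsum_prod' fun _ => ENNReal.summable]
  refine tsum_congr fun x => ?_
  rw [← ENNReal.tsum_mul_left, ← ENNReal.tsum_mul_right]
  refine tsum_congr fun y => ?_
  rw [Measure.map_apply hTS (measurableSet_singleton _),
    Measure.map_apply hT (measurableSet_singleton _)]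
  -- The `step` axiom takes an infinite sequence; `Fin.ofNat` wraps around beyond `n`, where the
  -- values are never read.
  set x' : ℕ → V := fun i => x (Fin.ofNat (n + 1) i) with hx'
  have hxx : ∀ (i : ℕ) (hi : i ≤ n), x' i = x ⟨i, by omega⟩ := by
    intro i hi
    simp only [hx']
    congr 1
    ext
    simp [Fin.ofNat, Nat.mod_eq_of_lt (Nat.lt_succ_of_le hi)]
  have key : ∀ ω, (∀ i ≤ n, S i ω = x' i) ↔ (fun i : Fin (n + 1) => S i ω) = x := by
    intro ω
    constructor
    · intro h
      funext i
      rw [h i (by omega), hxx i (by omega)]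
    · rintro h i hi
      rw [hxx i hi, ← h]
  have hstep := hS.step n x' y
  simp only [key, hxx n le_rfl] at hstep
  have h1 : ((fun ω => ((fun i : Fin (n + 1) => S i ω), S (n + 1) ω)) ⁻¹' {(x, y)}) =
      {ω | (fun i : Fin (n + 1) => S i ω) = x ∧ S (n + 1) ω = y} := by
    ext ω; simp
  have h2 : ((fun ω => (fun i : Fin (n + 1) => S i ω)) ⁻¹' {x}) =
      {ω | (fun i : Fin (n + 1) => S i ω) = x} := by
    ext ω; simp
  rw [h1, h2]
  have h3 := congrArg ENNReal.ofReal hstep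
  rw [ENNReal.ofReal_mul measureReal_nonneg, ofReal_measureReal, ofReal_measureReal] at h3
  rw [h3]
  have : (⟨n, by omega⟩ : Fin (n + 1)) = Fin.last n := rfl
  rw [this]
  ring

theorem combGraph_neighborSet_of_ne {a b : ℤ} (hb : b ≠ 0) :
    combGraph.neighborSet (a, b) = {(a, b + 1), (a, b - 1)} := by
  ext ⟨c, d⟩
  simp only [SimpleGraph.mem_neighborSet, combGraph, Set.mem_insert_iff, Set.mem_singleton_iff,
    Prod.mk.injEq, hb, false_and, or_false]
  constructor
  · rintro ⟨rfl, h⟩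
    rcases eq_or_eq_neg_of_abs_eq h with h | h <;> omega
  · rintro (⟨rfl, rfl⟩ | ⟨rfl, rfl⟩) <;> simp

theorem combGraph_neighborSet_zero (a : ℤ) :
    combGraph.neighborSet (a, 0) = {(a, 1), (a, -1), (a + 1, 0), (a - 1, 0)} := by
  ext ⟨c, d⟩
  simp only [SimpleGraph.mem_neighborSet, combGraph, Set.mem_insert_iff, Set.mem_singleton_iff,
    Prod.mk.injEq, true_and, zero_sub, abs_neg]
  constructor
  · rintro (⟨rfl, h⟩ | ⟨rfl, h⟩) <;> rcases eq_or_eq_neg_of_abs_eq h with h | h <;> omega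
  · rintro (⟨rfl, rfl⟩ | ⟨rfl, rfl⟩ | ⟨rfl, rfl⟩ | ⟨rfl, rfl⟩) <;> simp

theorem tsum_srwProb_mul {V : Type*} [DecidableEq V] {G : SimpleGraph V} (x : V) (s : Finset V)
    (hs : G.neighborSet x = s) (g : V → ENNReal) :
    ∑' y, ENNReal.ofReal (srwProb G x y) * g y =
      ∑ y ∈ s, ENNReal.ofReal (1 / s.card) * g y := by
  have hadj : ∀ y, G.Adj x y ↔ y ∈ s := fun y => by
    rw [← SimpleGraph.mem_neighborSet, hs, Finset.mem_coe]
  rw [tsum_eq_sum (s := s)]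
  · refine Finset.sum_congr rfl fun y hy => ?_
    rw [srwProb, if_pos ((hadj y).2 hy), hs, Set.ncard_coe_finset]
  · intro y hy
    rw [srwProb, if_neg (fun h => hy ((hadj y).1 h))]
    simp

/-- One step of the walk on the comb averages a function of the height `|y|` as the simple random
walk on `ℤ` folded at `-1/2` does. -/
theorem combGraph_tsum_srwProb_mul (x : ℤ × ℤ) (g : ℕ → ENNReal) :
    ∑' y, ENNReal.ofReal (srwProb combGraph x y) * g y.2.natAbs =
      2⁻¹ * (g (x.2.natAbs + 1) + g (x.2.natAbs - 1)) := by
  obtain ⟨a, b⟩ := x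
  have h2 : ENNReal.ofReal (1 / 2) = 2⁻¹ := by
    rw [one_div, ENNReal.ofReal_inv_of_pos two_pos]; simp
  have h4 : ENNReal.ofReal (1 / 4) = 4⁻¹ := by
    rw [one_div, ENNReal.ofReal_inv_of_pos four_pos]; simp
  rcases eq_or_ne b 0 with rfl | hb
  · rw [tsum_srwProb_mul (G := combGraph) (a, (0 : ℤ)) {(a, 1), (a, -1), (a + 1, 0), (a - 1, 0)}
      (by rw [combGraph_neighborSet_zero]; simp) (fun y : ℤ × ℤ => g y.2.natAbs)]
    have hc : ({(a, 1), (a, -1), (a + 1, 0), (a - 1, 0)} : Finset (ℤ × ℤ)).card = 4 := by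
      rw [Finset.card_insert_of_notMem, Finset.card_insert_of_notMem,
        Finset.card_insert_of_notMem, Finset.card_singleton]
      all_goals simp
      omega
    rw [hc]
    push_cast
    rw [h4, Finset.sum_insert, Finset.sum_insert, Finset.sum_insert, Finset.sum_singleton]
    · simp only [Int.natAbs_one, Int.natAbs_neg, Int.natAbs_zero]
      have : (2⁻¹ : ENNReal) = 4⁻¹ + 4⁻¹ := by
        rw [← two_mul, show (4 : ENNReal) = 2 * 2 by norm_num, ENNReal.mul_inv (by simp) (by simp),
          ← mul_assoc, ENNReal.mul_inv_cancel (by simp) (by simp), one_mul]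
      rw [this]
      ring
    all_goals simp
    omega
  · rw [tsum_srwProb_mul (G := combGraph) (a, b) {(a, b + 1), (a, b - 1)}
      (by rw [combGraph_neighborSet_of_ne hb]; simp) (fun y : ℤ × ℤ => g y.2.natAbs)]
    have hne : (a, b + 1) ≠ (a, b - 1) := by simp; omega
    rw [Finset.card_pair hne, Finset.sum_pair hne]
    push_cast
    rw [h2, ← mul_add]
    congr 1
    rcases lt_or_gt_of_ne hb with h | h
    · have e1 : (b + 1).natAbs = b.natAbs - 1 := by omega
      have e2 : (b - 1).natAbs = b.natAbs + 1 := by omega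
      simp only [e1, e2, add_comm]
    · have e1 : (b + 1).natAbs = b.natAbs + 1 := by omega
      have e2 : (b - 1).natAbs = b.natAbs - 1 := by omega
      simp only [e1, e2]

theorem maxVerticalDeviation_lt_iff {Ω : Type*} (S : ℕ → Ω → ℤ × ℤ) (n h : ℕ) (hh : 0 < h)
    (ω : Ω) : maxVerticalDeviation S n ω < h ↔ ∀ i : Fin (n + 1), (S i ω).2.natAbs < h := by
  rw [maxVerticalDeviation, Finset.sup_lt_iff (by simpa using hh)]
  constructor
  · exact fun H i => H i (Finset.mem_range.2 i.2)
  · exact fun H i hi => H ⟨i, Finset.mem_range.1 hi⟩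

theorem measurable_maxVerticalDeviation {Ω : Type*} [MeasurableSpace Ω] {S : ℕ → Ω → ℤ × ℤ}
    (hS : ∀ n, Measurable (S n)) (n : ℕ) : Measurable (maxVerticalDeviation S n) := by
  have : maxVerticalDeviation S n =
      fun ω => (fun x : Fin (n + 1) → ℤ × ℤ => Finset.univ.sup fun i => (x i).2.natAbs)
        (fun i => S i ω) := by
    funext ω
    rw [maxVerticalDeviation]
    apply le_antisymm
    · refine Finset.sup_le fun i hi => ?_
      exact Finset.le_sup (f := fun i : Fin (n + 1) => (S i ω).2.natAbs)
        (Finset.mem_univ ⟨i, Finset.mem_range.1 hi⟩)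
    · refine Finset.sup_le fun i _ => ?_
      exact Finset.le_sup (f := fun i : ℕ => (S i ω).2.natAbs) (Finset.mem_range.2 i.2)
  rw [this]
  have hm : Measurable fun x : Fin (n + 1) → ℤ × ℤ => Finset.univ.sup fun i => (x i).2.natAbs :=
    measurable_of_countable _
  exact hm.comp (measurable_pi_lambda _ fun i : Fin (n + 1) => hS i)

/-- If `q m k` solves the folded heat equation below height `h` with killing at `h`, then `q n 0`
is the probability that the vertical deviation of the walk stays below `h` for `n` steps. -/
theorem measure_maxVerticalDeviation_lt {Ω : Type*} [MeasurableSpace Ω] {μ : Measure Ω}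
    [IsProbabilityMeasure μ] {S : ℕ → Ω → ℤ × ℤ} (hS : IsSimpleRandomWalk combGraph (0, 0) μ S)
    {h : ℕ} (hh : 0 < h) (q : ℕ → ℕ → ENNReal) (hq0 : ∀ k < h, q 0 k = 1)
    (hqh : ∀ m, q m h = 0)
    (hq : ∀ m, ∀ k < h, q (m + 1) k = 2⁻¹ * (q m (k + 1) + q m (k - 1))) (n : ℕ) :
    μ {ω | maxVerticalDeviation S n ω < h} = q n 0 := by
  classical
  set F : (n : ℕ) → (Fin (n + 1) → ℤ × ℤ) → ENNReal :=
    fun n x => if ∀ i, (x i).2.natAbs < h then 1 else 0 with hF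
  -- The walk survives until time `n`, and `q` accounts for the remaining `m` steps; the value
  -- depends only on `n + m`.
  set M : ℕ → ℕ → ENNReal := fun n m =>
    ∫⁻ ω, F n (fun i => S i ω) * q m (S n ω).2.natAbs ∂μ with hM
  have step : ∀ n m, M n (m + 1) = M (n + 1) m := by
    intro n m
    -- Cutting `q m` off at `h` costs nothing: from below `h` one step reaches at most `h`, where `q
    -- m` vanishes.
    have hmark := hS.lintegral_past_mul n (F n)
      (fun y => (fun k => if k < h then q m k else 0) y.2.natAbs)
    simp only [combGraph_tsum_srwProb_mul _ (fun k => if k < h then q m k else 0)] at hmark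
    have e1 : M (n + 1) m = ∫⁻ ω, F n (fun i => S i ω) *
        (if (S (n + 1) ω).2.natAbs < h then q m (S (n + 1) ω).2.natAbs else 0) ∂μ := by
      refine lintegral_congr fun ω => ?_
      simp only [hF, Fin.forall_fin_succ' (n := n + 1), Fin.val_castSucc, Fin.val_last]
      by_cases h1 : ∀ i : Fin (n + 1), (S i ω).2.natAbs < h <;>
        by_cases h2 : (S (n + 1) ω).2.natAbs < h <;> simp [h1, h2]
    rw [e1, hmark]
    refine lintegral_congr fun ω => ?_
    by_cases h1 : ∀ i : Fin (n + 1), (S i ω).2.natAbs < h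
    · have hk : (S n ω).2.natAbs < h := h1 (Fin.last n)
      congr 1
      rw [hq m _ hk]
      have h3 : (S n ω).2.natAbs - 1 < h := by omega
      by_cases h4 : (S n ω).2.natAbs + 1 < h
      · simp [h3, h4]
      · have : (S n ω).2.natAbs + 1 = h := by omega
        simp [h3, this, hqh]
    · simp [hF, h1]
  have M0 : ∀ m n, M n m = M (n + m) 0 := by
    intro m
    induction m with
    | zero => intro n; rfl
    | succ m ih => intro n; rw [step, ih]; congr 1; omega
  have hfin : M n 0 = μ {ω | maxVerticalDeviation S n ω < h} := by
    have hms : MeasurableSet {ω | maxVerticalDeviation S n ω < h} :=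
      measurable_maxVerticalDeviation hS.measurable n measurableSet_Iio
    rw [← lintegral_indicator_one hms]
    refine lintegral_congr fun ω => ?_
    simp only [hF, Set.indicator_apply, Set.mem_ofPred_eq, maxVerticalDeviation_lt_iff S n h hh]
    split_ifs with h1
    · have h2 : (S n ω).2.natAbs < h := h1 (Fin.last n)
      rw [hq0 _ h2]; simp
    · simp
  have hini : M 0 n = q n 0 := by
    have : ∀ᵐ ω ∂μ, F 0 (fun i => S i ω) * q n (S 0 ω).2.natAbs = q n 0 := by
      filter_upwards [hS.start] with ω hω
      simp [hF, hω, hh]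
    rw [hM]
    simp only
    rw [lintegral_congr_ae this]
    simp
  rw [← hfin, ← hini, M0 n 0, zero_add]

/-! ### Simple random walk on ℤ and the method of images -/

/-- `walkMean n f w` is the mean of `f (w + W n)` for the simple random walk `W` on `ℤ`. -/
noncomputable def walkMean : ℕ → (ℤ → ℝ) → ℤ → ℝ
  | 0, f, w => f w
  | n + 1, f, w => (walkMean n f (w + 1) + walkMean n f (w - 1)) / 2

/-- The square wave of values `±1` and half-period `2 * h + 1` which is `1` on `[-h, h]`. -/
noncomputable def squareWave (h : ℕ) (w : ℤ) : ℝ := (-1) ^ ((w + h) / (2 * h + 1))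

/-- The probability that the simple random walk on `ℤ` started at `w` stays in `[-h, h - 1]` for
`n` steps, by the method of images. -/
noncomputable def survival (h n : ℕ) (w : ℤ) : ℝ :=
  (walkMean n (squareWave h) w + walkMean n (squareWave h) (w + 1)) / 2

theorem squareWave_neg (h : ℕ) (w : ℤ) : squareWave h (-w) = squareWave h w := by
  have hp : (0 : ℤ) < 2 * h + 1 := by positivity
  have h1 : (-w + h) / (2 * h + 1 : ℤ) = -((w + h) / (2 * h + 1)) := by
    have := Int.emod_add_mul_ediv (w + h) (2 * h + 1)
    have h2 := Int.emod_nonneg (w + h) hp.ne'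
    have h3 := Int.emod_lt_of_pos (w + h) hp
    refine Int.ediv_eq_iff_of_pos hp |>.2 ⟨?_, ?_⟩ <;> nlinarith
  rw [squareWave, h1, zpow_neg, ← inv_zpow, inv_neg, inv_one, squareWave]

theorem squareWave_add (h : ℕ) (w : ℤ) :
    squareWave h (w + (2 * h + 1)) = -squareWave h w := by
  have hp : (2 * h + 1 : ℤ) ≠ 0 := by positivity
  rw [squareWave, add_right_comm, Int.add_ediv_of_dvd_right dvd_rfl, Int.ediv_self hp,
    zpow_add₀ (by norm_num), squareWave]
  ring

theorem squareWave_of_abs_le {h : ℕ} {w : ℤ} (hw : |w| ≤ h) : squareWave h w = 1 := by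
  rw [abs_le] at hw
  rw [squareWave, Int.ediv_eq_zero_of_lt (by omega) (by omega), zpow_zero]

theorem walkMean_neg {f : ℤ → ℝ} (hf : ∀ w, f (-w) = f w) (n : ℕ) (w : ℤ) :
    walkMean n f (-w) = walkMean n f w := by
  induction n generalizing w with
  | zero => exact hf w
  | succ n ih =>
    rw [walkMean, walkMean, ← ih (w + 1), ← ih (w - 1), add_comm]
    congr 3 <;> ring

theorem walkMean_antiperiodic {f : ℤ → ℝ} {p : ℤ} (hf : ∀ w, f (w + p) = -f w) (n : ℕ) (w : ℤ) :
    walkMean n f (w + p) = -walkMean n f w := by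
  induction n generalizing w with
  | zero => exact hf w
  | succ n ih =>
    rw [walkMean, walkMean, add_right_comm, ih, show w + p - 1 = w - 1 + p by ring, ih]
    ring

/-- Only points within reach in `n` steps matter; this locality later allows truncation of the sums
over `h`. -/
theorem walkMean_mono {f g : ℤ → ℝ} (n : ℕ) (w : ℤ) (hfg : ∀ k, |k - w| ≤ n → f k ≤ g k) :
    walkMean n f w ≤ walkMean n g w := by
  induction n generalizing w with
  | zero => exact hfg w (by simp)
  | succ n ih =>
    have h1 := ih (w + 1) fun k hk => hfg k (by push_cast; rw [abs_le] at *; omega)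
    have h2 := ih (w - 1) fun k hk => hfg k (by push_cast; rw [abs_le] at *; omega)
    rw [walkMean, walkMean]
    linarith

theorem walkMean_congr {f g : ℤ → ℝ} (n : ℕ) (w : ℤ) (hfg : ∀ k, |k - w| ≤ n → f k = g k) :
    walkMean n f w = walkMean n g w :=
  le_antisymm (walkMean_mono n w fun k hk => (hfg k hk).le)
    (walkMean_mono n w fun k hk => (hfg k hk).ge)

theorem walkMean_const (c : ℝ) (n : ℕ) (w : ℤ) : walkMean n (fun _ => c) w = c := by
  induction n generalizing w with
  | zero => rfl
  | succ n ih => rw [walkMean, ih, ih]; ring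

theorem walkMean_add (f g : ℤ → ℝ) (n : ℕ) (w : ℤ) :
    walkMean n (fun k => f k + g k) w = walkMean n f w + walkMean n g w := by
  induction n generalizing w with
  | zero => rfl
  | succ n ih => simp only [walkMean, ih]; ring

theorem walkMean_const_mul (c : ℝ) (f : ℤ → ℝ) (n : ℕ) (w : ℤ) :
    walkMean n (fun k => c * f k) w = c * walkMean n f w := by
  induction n generalizing w with
  | zero => rfl
  | succ n ih => simp only [walkMean, ih]; ring

theorem walkMean_sum {ι : Type*} (s : Finset ι) (f : ι → ℤ → ℝ) (n : ℕ) (w : ℤ) :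
    walkMean n (fun k => ∑ i ∈ s, f i k) w = ∑ i ∈ s, walkMean n (f i) w := by
  induction n generalizing w with
  | zero => rfl
  | succ n ih => simp only [walkMean, ih, ← Finset.sum_add_distrib, ← Finset.sum_div]

theorem survival_succ (h n : ℕ) (w : ℤ) :
    survival h (n + 1) w = (survival h n (w + 1) + survival h n (w - 1)) / 2 := by
  simp only [survival, walkMean]
  rw [show w + 1 - 1 = w by ring, show w - 1 + 1 = w by ring]
  ring

/-- Evenness and antiperiodicity make the evolved wave odd about `h + 1/2`, so its values at `h` and
`h + 1` cancel. -/
theorem survival_self (h n : ℕ) : survival h n h = 0 := by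
  have h1 := walkMean_antiperiodic (squareWave_add h) n (-h)
  rw [walkMean_neg (squareWave_neg h), show -(h : ℤ) + (2 * h + 1) = h + 1 by ring] at h1
  rw [survival, h1]
  ring

theorem survival_neg_one (h n : ℕ) : survival h n (-1) = survival h n 0 := by
  rw [survival, survival, walkMean_neg (squareWave_neg h)]
  norm_num
  ring

theorem survival_zero_of_lt {h k : ℕ} (hk : k < h) : survival h 0 k = 1 := by
  rw [survival, walkMean, walkMean, squareWave_of_abs_le, squareWave_of_abs_le]
  · norm_num
  · rw [abs_le]; omega
  · rw [abs_le]; omega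

theorem survival_of_lt {h n : ℕ} (hn : n < h) : survival h n 0 = 1 := by
  have key : ∀ w : ℤ, |w| + n ≤ h → walkMean n (squareWave h) w = 1 := by
    intro w hw
    rw [← walkMean_const 1 n w]
    refine walkMean_congr n w fun k hk => squareWave_of_abs_le ?_
    have := abs_sub_abs_le_abs_sub k w
    omega
  rw [survival, key _ (by simp; omega), key _ (by norm_num; omega)]
  norm_num

/-- Truncated subtraction at `k = 0` is exactly the reflection at `-1/2`. -/
theorem survival_pred (h n k : ℕ) : survival h n ((k : ℤ) - 1) = survival h n ((k - 1 : ℕ) : ℤ) := by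
  rcases Nat.eq_zero_or_pos k with rfl | hk
  · simpa using survival_neg_one h n
  · rw [Nat.cast_sub hk]; simp

/-- Maximum principle on `[0, h]`: the image formula has signs, so positivity comes from the
recurrence and the boundary values. -/
theorem survival_mem_Icc {h : ℕ} (n k : ℕ) (hk : k ≤ h) : survival h n k ∈ Set.Icc (0 : ℝ) 1 := by
  induction n generalizing k with
  | zero =>
    rcases hk.lt_or_eq with hk | rfl
    · simp [survival_zero_of_lt hk]
    · simp [survival_self]
  | succ n ih =>
    rcases hk.lt_or_eq with hk | rfl
    · rw [survival_succ, survival_pred]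
      have h1 := ih (k + 1) hk
      have h2 := ih (k - 1) (by omega)
      push_cast at h1
      constructor <;> linarith [h1.1, h1.2, h2.1, h2.2]
    · simp [survival_self]

/-! ### Distribution and mean of the vertical deviation -/

section Comb

variable {Ω : Type*} [MeasurableSpace Ω] {μ : Measure Ω} [IsProbabilityMeasure μ]
  {S : ℕ → Ω → ℤ × ℤ}

theorem measure_maxVerticalDeviation_lt_eq_survival
    (hS : IsSimpleRandomWalk combGraph (0, 0) μ S) {h : ℕ} (hh : 0 < h) (n : ℕ) :
    μ.real {ω | maxVerticalDeviation S n ω < h} = survival h n 0 := by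
  have := measure_maxVerticalDeviation_lt hS hh (fun m k => ENNReal.ofReal (survival h m k))
    (fun k hk => by simp [survival_zero_of_lt hk]) (fun m => by simp [survival_self])
    (fun m k hk => by
      rw [survival_succ, survival_pred, ENNReal.ofReal_div_of_pos two_pos,
        ENNReal.ofReal_add (by exact_mod_cast (survival_mem_Icc m (k + 1) hk).1)
          (survival_mem_Icc m (k - 1) (by omega)).1, ENNReal.div_eq_inv_mul]
      simp) n
  rw [measureReal_def, this, Nat.cast_zero, ENNReal.toReal_ofReal]
  exact (survival_mem_Icc n 0 (Nat.zero_le _)).1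

theorem maxVerticalDeviation_le_ae (hS : IsSimpleRandomWalk combGraph (0, 0) μ S) (n : ℕ) :
    ∀ᵐ ω ∂μ, maxVerticalDeviation S n ω ≤ n := by
  have h1 := measure_maxVerticalDeviation_lt_eq_survival hS n.succ_pos n
  rw [survival_of_lt n.lt_succ_self] at h1
  have hms : MeasurableSet {ω | maxVerticalDeviation S n ω < n + 1} :=
    measurable_maxVerticalDeviation hS.measurable n measurableSet_Iio
  have h2 : μ {ω | maxVerticalDeviation S n ω < n + 1} = 1 := by
    rw [← ofReal_measureReal, h1, ENNReal.ofReal_one]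
  filter_upwards [(mem_ae_iff_prob_eq_one hms).2 h2] with ω hω
  exact Nat.lt_succ_iff.1 hω

theorem integrable_maxVerticalDeviation (hS : IsSimpleRandomWalk combGraph (0, 0) μ S) (n : ℕ) :
    Integrable (fun ω => (maxVerticalDeviation S n ω : ℝ)) μ := by
  refine Integrable.of_bound (C := n) ?_ ?_
  · exact (measurable_of_countable (fun k : ℕ => (k : ℝ))).comp
      (measurable_maxVerticalDeviation hS.measurable n) |>.aestronglyMeasurable
  · filter_upwards [maxVerticalDeviation_le_ae hS n] with ω hω
    simpa using hω

/-- Tail-sum formula. The cutoff `N` is left free because the generating function uses `n` and the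
asymptotics `n + 1`. -/
theorem integral_maxVerticalDeviation (hS : IsSimpleRandomWalk combGraph (0, 0) μ S) {n N : ℕ}
    (hN : n ≤ N) :
    ∫ ω, (maxVerticalDeviation S n ω : ℝ) ∂μ =
      ∑ h ∈ Finset.range N, (1 - survival (h + 1) n 0) := by
  have hms : ∀ h, MeasurableSet {ω | maxVerticalDeviation S n ω < h} := fun h =>
    measurable_maxVerticalDeviation hS.measurable n measurableSet_Iio
  have h1 : ∀ᵐ ω ∂μ, (maxVerticalDeviation S n ω : ℝ) = ∑ h ∈ Finset.range N,
      {ω | maxVerticalDeviation S n ω < h + 1}ᶜ.indicator (fun _ => (1 : ℝ)) ω := by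
    filter_upwards [maxVerticalDeviation_le_ae hS n] with ω hω
    have : ∀ h, {ω | maxVerticalDeviation S n ω < h + 1}ᶜ.indicator (fun _ => (1 : ℝ)) ω =
        if h < maxVerticalDeviation S n ω then 1 else 0 := by
      intro h
      simp [Set.indicator_apply]
    simp only [this]
    rw [← Finset.sum_filter]
    have h2 : (Finset.range N).filter (· < maxVerticalDeviation S n ω) =
        Finset.range (maxVerticalDeviation S n ω) := by
      ext k; simp; omega
    rw [h2]
    simp
  rw [integral_congr_ae h1, integral_finsetSum]
  · refine Finset.sum_congr rfl fun h _ => ?_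
    rw [integral_indicator_const _ (hms (h + 1)).compl, smul_eq_mul, mul_one,
      probReal_compl_eq_one_sub (hms (h + 1)),
      measure_maxVerticalDeviation_lt_eq_survival hS h.succ_pos]
  · exact fun h _ => (integrable_const (1 : ℝ)).indicator (hms (h + 1)).compl

end Comb

/-! ### The generating function -/

section GeneratingFunction

variable {z v : ℂ}

theorem summable_survival_mul_pow (hz : ‖z‖ < 1) {h k : ℕ} (hk : k ≤ h) :
    Summable fun n : ℕ => (survival h n k : ℂ) * z ^ n := by
  refine Summable.of_norm_bounded (summable_geometric_of_lt_one (norm_nonneg z) hz) fun n => ?_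
  obtain ⟨h0, h1⟩ := survival_mem_Icc n k hk
  rw [norm_mul, norm_pow, Complex.norm_real, Real.norm_of_nonneg h0]
  exact mul_le_of_le_one_left (by positivity) h1

theorem tsum_survival_eq (hz : ‖z‖ < 1) {h k : ℕ} (hk : k < h) :
    ∑' n : ℕ, (survival h n k : ℂ) * z ^ n = 1 + z / 2 *
      (∑' n : ℕ, (survival h n (k + 1 : ℕ) : ℂ) * z ^ n +
        ∑' n : ℕ, (survival h n (k - 1 : ℕ) : ℂ) * z ^ n) := by
  have h1 := summable_survival_mul_pow hz (k := k + 1) hk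
  have h2 := summable_survival_mul_pow hz (h := h) (k := k - 1) (by omega)
  rw [(summable_survival_mul_pow hz hk.le).tsum_eq_zero_add, ← h1.tsum_add h2, ← tsum_mul_left,
    survival_zero_of_lt hk]
  congr 1
  · simp
  · refine tsum_congr fun n => ?_
    rw [survival_succ, survival_pred]
    push_cast
    ring

/-- A solution of the discrete boundary value problem, compared to its value at `0`. -/
theorem pow_mul_eq_of_recurrence {g : ℕ → ℂ} {h : ℕ}
    (hg : ∀ k < h, (1 + v ^ 2) * g k = v * (g (k + 1) + g (k - 1))) (k : ℕ) (hk : k ≤ h) :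
    v ^ k * g k * (1 + v) = g 0 * (1 + v ^ (2 * k + 1)) := by
  induction k using Nat.twoStepInduction with
  | zero => ring
  | one =>
    have := hg 0 hk
    -- At `k = 0` the recurrence reads `g (0 - 1) = g 0`: the reflecting condition, which selects
    -- the solution `v^(-k) + v^(k+1)`.
    simp only [zero_add, Nat.zero_sub] at this
    linear_combination (-1 - v) * this
  | more k ih1 ih2 =>
    have := hg (k + 1) hk
    simp only [Nat.add_sub_cancel] at this
    have i1 := ih1 (by omega)
    have i2 := ih2 (by omega)
    linear_combination (-v ^ (k + 1) * (1 + v)) * this + (1 + v ^ 2) * i2 - v ^ 2 * i1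

theorem hasSum_one_sub_survival (hz : ‖z‖ < 1) (hv : 1 + v ^ 2 ≠ 0)
    (hzv : v / (1 + v ^ 2) = z / 2) (h : ℕ) :
    HasSum (fun n : ℕ => ((1 - survival h n 0 : ℝ) : ℂ) * z ^ n)
      ((1 + v ^ 2) * (1 + v) / (1 - v) ^ 2 * (v ^ h / (1 + v ^ (2 * h + 1)))) := by
  have hz2 : z * (1 + v ^ 2) = 2 * v := by
    field_simp at hzv
    linear_combination -hzv
  have hz1 : (1 - z) ≠ 0 := by
    intro h0
    rw [← sub_eq_zero.1 h0] at hz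
    simp at hz
  have hv1 : 1 - v ≠ 0 := by
    intro h0
    rw [← sub_eq_zero.1 h0] at hz2
    apply hz1
    linear_combination (-1 / 2 : ℂ) * hz2
  have hv1' : 1 + v ≠ 0 := by
    intro h0
    have : v = -1 := by linear_combination h0
    rw [this] at hz2
    have : z = -1 := by linear_combination (1 / 2 : ℂ) * hz2
    rw [this] at hz
    simp at hz
  have hzz : (1 - z) * (1 + v ^ 2) = (1 - v) ^ 2 := by linear_combination -hz2
  set f : ℕ → ℂ := fun k => ∑' n : ℕ, (survival h n k : ℂ) * z ^ n with hf
  -- The constant `(1 - z)⁻¹` is a particular solution; subtracting it makes the recurrence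
  -- homogeneous.
  have hrec : ∀ k < h, (1 + v ^ 2) * (f k - (1 - z)⁻¹) =
      v * (f (k + 1) - (1 - z)⁻¹ + (f (k - 1) - (1 - z)⁻¹)) := by
    intro k hk
    have h1 : f k = 1 + z / 2 * (f (k + 1) + f (k - 1)) := tsum_survival_eq hz hk
    have h2 : (1 - z) * (1 - z)⁻¹ = 1 := mul_inv_cancel₀ hz1
    linear_combination (1 + v ^ 2) * h1 - (1 + v ^ 2) * h2 +
      ((f (k + 1) + f (k - 1)) / 2 - (1 - z)⁻¹) * hz2
  have hfh : f h = 0 := by simp [hf, survival_self]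
  have hend := pow_mul_eq_of_recurrence (g := fun k => f k - (1 - z)⁻¹) hrec h le_rfl
  simp only [hfh, zero_sub] at hend
  -- The identity at the killing height excludes a zero denominator, with no need to know whether
  -- `|v| < 1` or `|v| > 1`.
  have hpow : 1 + v ^ (2 * h + 1) ≠ 0 := by
    intro h0
    rw [h0, mul_zero] at hend
    have hv0 : v = 0 := by
      by_contra hne
      exact mul_ne_zero (mul_ne_zero (pow_ne_zero h hne) (neg_ne_zero.2 (inv_ne_zero hz1))) hv1'
        hend
    simp [hv0] at h0
  have hs := (hasSum_geometric_of_norm_lt_one hz).sub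
    (summable_survival_mul_pow hz (Nat.zero_le h)).hasSum
  have hfun : (fun n : ℕ => z ^ n - (survival h n (0 : ℕ) : ℂ) * z ^ n) =
      fun n : ℕ => ((1 - survival h n 0 : ℝ) : ℂ) * z ^ n := by
    funext n
    push_cast
    ring
  have hval : (1 - z)⁻¹ - f 0 =
      (1 + v ^ 2) * (1 + v) / (1 - v) ^ 2 * (v ^ h / (1 + v ^ (2 * h + 1))) := by
    have h3 : (1 - z)⁻¹ - f 0 = v ^ h * (1 + v) * (1 - z)⁻¹ / (1 + v ^ (2 * h + 1)) := by
      rw [eq_div_iff hpow]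
      linear_combination hend
    rw [h3, ← hzz]
    field_simp
  rw [← hfun, ← hval]
  exact hs

/-- Fubini for the double series in `(n, h)`: row `n` has at most `n` nonzero entries, each at most
`‖z‖^n`. Convergence of the series in `v` comes out of this as well, for both roots `v` and `1/v`.
-/
theorem hasSum_deviation (hz : ‖z‖ < 1) (hv : 1 + v ^ 2 ≠ 0)
    (hzv : v / (1 + v ^ 2) = z / 2) {d : ℕ → ℝ}
    (hd : ∀ n, d n = ∑ h ∈ Finset.range n, (1 - survival (h + 1) n 0)) :
    Summable (fun h : ℕ => v ^ (h + 1) / (1 + v ^ (2 * (h + 1) + 1))) ∧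
      HasSum (fun n : ℕ => (d n : ℂ) * z ^ n)
        ((1 + v ^ 2) * (1 + v) / (1 - v) ^ 2 *
          ∑' h : ℕ, v ^ (h + 1) / (1 + v ^ (2 * (h + 1) + 1))) := by
  have hz2 : z * (1 + v ^ 2) = 2 * v := by
    field_simp at hzv
    linear_combination -hzv
  have hv1 : 1 - v ≠ 0 := by
    intro h0
    rw [← sub_eq_zero.1 h0] at hz2
    have : z = 1 := by linear_combination (1 / 2 : ℂ) * hz2
    rw [this] at hz
    simp at hz
  have hv1' : 1 + v ≠ 0 := by
    intro h0
    have : v = -1 := by linear_combination h0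
    rw [this] at hz2
    have : z = -1 := by linear_combination (1 / 2 : ℂ) * hz2
    rw [this] at hz
    simp at hz
  have hC : (1 + v ^ 2) * (1 + v) / (1 - v) ^ 2 ≠ 0 :=
    div_ne_zero (mul_ne_zero hv hv1') (pow_ne_zero 2 hv1)
  obtain ⟨F, hF⟩ : ∃ F : ℕ × ℕ → ℂ, ∀ n h,
      F (n, h) = ((1 - survival (h + 1) n 0 : ℝ) : ℂ) * z ^ n :=
    ⟨fun p => ((1 - survival (p.2 + 1) p.1 0 : ℝ) : ℂ) * z ^ p.1, fun _ _ => rfl⟩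
  have hF0 : ∀ n h, h ∉ Finset.range n → F (n, h) = 0 := by
    intro n h hh
    rw [Finset.mem_range, not_lt] at hh
    simp [hF, survival_of_lt (Nat.lt_succ_of_le hh)]
  have hnorm : ∀ n h, ‖F (n, h)‖ ≤ ‖z‖ ^ n := by
    intro n h
    obtain ⟨h0, h1⟩ := survival_mem_Icc n 0 (Nat.zero_le (h + 1))
    simp only [Nat.cast_zero] at h0 h1
    rw [hF, norm_mul, norm_pow, Complex.norm_real, Real.norm_of_nonneg (by linarith)]
    exact mul_le_of_le_one_left (by positivity) (by linarith)
  have hsum : Summable F := by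
    refine Summable.of_norm ((summable_prod_of_nonneg fun _ => norm_nonneg _).2 ⟨fun n => ?_, ?_⟩)
    · exact summable_of_ne_finset_zero (s := Finset.range n) fun h hh => by simp [hF0 n h hh]
    · have hgeo : Summable fun n : ℕ => (n : ℝ) * ‖z‖ ^ n := by
        simpa using summable_pow_mul_geometric_of_norm_lt_one 1 (r := ‖z‖) (by simpa using hz)
      refine Summable.of_nonneg_of_le (fun n => tsum_nonneg fun _ => norm_nonneg _)
        (fun n => ?_) hgeo
      rw [tsum_eq_sum (s := Finset.range n) fun h hh => by simp [hF0 n h hh]]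
      refine (Finset.sum_le_card_nsmul _ _ _ fun h _ => hnorm n h).trans ?_
      simp
  have hrow : ∀ n, HasSum (fun h => F (n, h)) ((d n : ℂ) * z ^ n) := by
    intro n
    have h0 : (d n : ℂ) * z ^ n = ∑ h ∈ Finset.range n, F (n, h) := by
      rw [hd n, Complex.ofReal_sum, Finset.sum_mul]
      exact Finset.sum_congr rfl fun h _ => (hF n h).symm
    rw [h0]
    exact hasSum_sum_of_ne_finset_zero (hF0 n)
  have hcol : ∀ h, HasSum (fun n => F (n, h)) ((1 + v ^ 2) * (1 + v) / (1 - v) ^ 2 *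
      (v ^ (h + 1) / (1 + v ^ (2 * (h + 1) + 1)))) := by
    intro h
    simp only [hF]
    exact hasSum_one_sub_survival hz hv hzv (h + 1)
  have h1 : HasSum (fun n => (d n : ℂ) * z ^ n) (∑' p, F p) :=
    HasSum.prod_fiberwise hsum.hasSum hrow
  have h2 : HasSum (fun h : ℕ => (1 + v ^ 2) * (1 + v) / (1 - v) ^ 2 *
      (v ^ (h + 1) / (1 + v ^ (2 * (h + 1) + 1)))) (∑' p, F p) :=
    HasSum.prod_fiberwise (f := fun p : ℕ × ℕ => F p.swap)
      ((Equiv.prodComm ℕ ℕ).hasSum_iff.2 hsum.hasSum) hcol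
  have hS : Summable (fun h : ℕ => v ^ (h + 1) / (1 + v ^ (2 * (h + 1) + 1))) :=
    (summable_mul_left_iff hC).1 h2.summable
  refine ⟨hS, ?_⟩
  rw [← tsum_mul_left, h2.tsum_eq]
  exact h1

end GeneratingFunction

/-! ### The tridiagonal determinant -/

theorem tridiagMatrix_apply (i : ℕ) (w : ℂ) (j k : Fin (i + 1)) :
    tridiagMatrix i w j k =
      if (j : ℕ) = k then 1 else if (j : ℕ) + 1 = k ∨ (k : ℕ) + 1 = j then -w else 0 := by
  simp only [tridiagMatrix, Matrix.of_apply, Fin.ext_iff]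

/-- Laplace expansion along the first row; the off-diagonal minor is then expanded along its first
column. -/
theorem tridiagMatrix_det_add_two (i : ℕ) (w : ℂ) :
    (tridiagMatrix (i + 2) w).det =
      (tridiagMatrix (i + 1) w).det - w ^ 2 * (tridiagMatrix i w).det := by
  have hsucc : ∀ (n : ℕ) (j k : Fin (n + 1)),
      tridiagMatrix (n + 1) w j.succ k.succ = tridiagMatrix n w j k := by
    intro n j k
    simp only [tridiagMatrix_apply, Fin.val_succ, Nat.add_right_cancel_iff]
  have h00 : tridiagMatrix (i + 2) w 0 0 = 1 := by simp [tridiagMatrix_apply]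
  have h01 : tridiagMatrix (i + 2) w 0 (Fin.succ 0) = -w := by simp [tridiagMatrix_apply]
  have h10 : tridiagMatrix (i + 2) w (Fin.succ 0) 0 = -w := by simp [tridiagMatrix_apply]
  have h0 : ∀ j : Fin (i + 1), tridiagMatrix (i + 2) w 0 j.succ.succ = 0 := by
    intro j; simp [tridiagMatrix_apply]
  have h0' : ∀ j : Fin (i + 1), tridiagMatrix (i + 2) w j.succ.succ 0 = 0 := by
    intro j; simp [tridiagMatrix_apply]
  have hA : (tridiagMatrix (i + 2) w).submatrix Fin.succ (Fin.succAbove 0) =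
      tridiagMatrix (i + 1) w := by
    ext j k
    rw [Matrix.submatrix_apply, Fin.succAbove_zero, hsucc]
  have hB : ((tridiagMatrix (i + 2) w).submatrix Fin.succ
      (Fin.succAbove (Fin.succ 0))).det = -w * (tridiagMatrix i w).det := by
    rw [Matrix.det_succ_column_zero, Fin.sum_univ_succ, Finset.sum_eq_zero, add_zero]
    · have hC : ((tridiagMatrix (i + 2) w).submatrix Fin.succ
          (Fin.succAbove (Fin.succ 0))).submatrix (Fin.succAbove 0) Fin.succ =
          tridiagMatrix i w := by
        ext j k
        rw [Matrix.submatrix_apply, Matrix.submatrix_apply, Fin.succAbove_zero,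
          Fin.succ_succAbove_succ, Fin.succAbove_zero, hsucc, hsucc]
      rw [hC, Matrix.submatrix_apply, Fin.succ_succAbove_zero, h10, Fin.val_zero, pow_zero,
        one_mul]
    · intro j _
      rw [Matrix.submatrix_apply, Fin.succ_succAbove_zero, h0', mul_zero, zero_mul]
  rw [Matrix.det_succ_row_zero, Fin.sum_univ_succ, Fin.sum_univ_succ, Finset.sum_eq_zero, hA, hB,
    h00, h01]
  · simp only [Fin.val_succ, Fin.val_zero]
    ring
  · intro j _
    rw [h0, mul_zero, zero_mul]

theorem tridiagMatrix_det {z v : ℂ} (hv : 1 + v ^ 2 ≠ 0) (hv2 : v ^ 2 ≠ 1)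
    (hzv : v / (1 + v ^ 2) = z / 2) (i : ℕ) :
    (tridiagMatrix i (z / 2)).det =
      (1 - v ^ (2 * i + 4)) / ((1 - v ^ 2) * (1 + v ^ 2) ^ (i + 1)) := by
  have hv1 : 1 - v ^ 2 ≠ 0 := sub_ne_zero.2 hv2.symm
  rw [← hzv]
  induction i using Nat.twoStepInduction with
  | zero =>
    rw [Matrix.det_fin_one]
    simp only [tridiagMatrix, Matrix.of_apply, if_true]
    field_simp
    ring
  | one =>
    rw [Matrix.det_fin_two]
    simp [tridiagMatrix]
    field_simp
    ring
  | more i ih1 ih2 =>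
    rw [tridiagMatrix_det_add_two, ih1, ih2]
    field_simp
    ring

/-! ### The mean absolute value of the walk on ℤ -/

section AbsoluteMean

/-- The mean of `|W n|` for the simple random walk `W` on `ℤ` started at `0`. -/
noncomputable def walkAbsMean (n : ℕ) : ℝ := walkMean n (fun w => |(w : ℝ)|) 0

/-- The probability that the simple random walk on `ℤ` started at `w` is at `0` at time `n`. -/
noncomputable def walkHitZero (n : ℕ) (w : ℤ) : ℝ := walkMean n (fun k => if k = 0 then 1 else 0) w

theorem walkMean_succ' (n : ℕ) (f : ℤ → ℝ) (w : ℤ) :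
    walkMean (n + 1) f w = walkMean n (fun k => (f (k + 1) + f (k - 1)) / 2) w := by
  induction n generalizing w with
  | zero => rfl
  | succ n ih => rw [walkMean, ih, ih]; rfl

/-- Discrete Tanaka formula: averaging `|k ± 1|` gives `|k|`, plus 1 when `k = 0`. -/
theorem walkAbsMean_succ (n : ℕ) : walkAbsMean (n + 1) = walkAbsMean n + walkHitZero n 0 := by
  rw [walkAbsMean, walkMean_succ', walkAbsMean, walkHitZero, ← walkMean_add]
  refine walkMean_congr n 0 fun k _ => ?_
  rcases lt_trichotomy k 0 with hk | rfl | hk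
  · have h1 : (k : ℝ) + 1 ≤ 0 := by exact_mod_cast hk
    push_cast
    rw [if_neg hk.ne, abs_of_nonpos h1, abs_of_nonpos (by linarith), abs_of_nonpos (by linarith)]
    ring
  · norm_num
  · have h1 : 1 ≤ (k : ℝ) := by exact_mod_cast hk
    push_cast
    rw [if_neg hk.ne', abs_of_nonneg (by linarith), abs_of_nonneg (by linarith),
      abs_of_nonneg (by linarith)]
    ring

theorem walkHitZero_of_lt {n : ℕ} {w : ℤ} (hw : (n : ℤ) < |w|) : walkHitZero n w = 0 := by
  rw [← walkMean_const 0 n w]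
  refine walkMean_congr n w fun k hk => if_neg ?_
  rintro rfl
  rw [zero_sub, abs_neg] at hk
  omega

theorem walkHitZero_of_odd {n : ℕ} {w : ℤ} (hw : Odd (n + w)) : walkHitZero n w = 0 := by
  induction n generalizing w with
  | zero =>
    refine if_neg ?_
    rintro rfl
    simp at hw
  | succ n ih =>
    have h1 := ih (w := w + 1) (by convert hw using 1; push_cast; ring)
    have h2 := ih (w := w - 1) (by
      obtain ⟨m, hm⟩ := hw
      exact ⟨m - 1, by push_cast at hm; omega⟩)
    unfold walkHitZero at *
    rw [walkMean, h1, h2]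
    norm_num

/-- Here `k` counts the up-steps; the induction is Pascal's rule. -/
theorem walkHitZero_eq_choose (n k : ℕ) : walkHitZero n (n - 2 * k) = n.choose k / 2 ^ n := by
  induction n generalizing k with
  | zero =>
    rw [walkHitZero, walkMean]
    rcases k with _ | k
    · simp
    · rw [if_neg (by push_cast; omega)]
      simp
  | succ n ih =>
    have hstep : walkHitZero (n + 1) ((n + 1 : ℕ) - 2 * k) =
        (walkHitZero n ((n + 1 : ℕ) - 2 * k + 1) + walkHitZero n ((n + 1 : ℕ) - 2 * k - 1)) / 2 :=
      rfl
    rw [hstep, show ((n + 1 : ℕ) - 2 * k - 1 : ℤ) = n - 2 * k by push_cast; ring, ih]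
    rcases k with _ | k
    · rw [walkHitZero_of_lt (by push_cast; rw [abs_of_nonneg] <;> omega)]
      simp
      field_simp
      ring
    · rw [show ((n + 1 : ℕ) - 2 * (k + 1 : ℕ) + 1 : ℤ) = n - 2 * k by push_cast; ring, ih,
        Nat.choose_succ_succ]
      push_cast
      field_simp
      ring

theorem walkHitZero_mem_Icc (n : ℕ) : walkHitZero n 0 ∈ Set.Icc (0 : ℝ) 1 := by
  constructor
  · rw [← walkMean_const 0 n 0]
    exact walkMean_mono n 0 fun k _ => by split_ifs <;> norm_num
  · rw [← walkMean_const 1 n 0]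
    exact walkMean_mono n 0 fun k _ => by split_ifs <;> norm_num

theorem walkHitZero_two_mul (m : ℕ) : walkHitZero (2 * m) 0 = m.centralBinom / 4 ^ m := by
  have := walkHitZero_eq_choose (2 * m) m
  rw [show ((2 * m : ℕ) - 2 * m : ℤ) = 0 by push_cast; ring, pow_mul] at this
  rw [this, Nat.centralBinom_eq_two_mul_choose]
  norm_num

theorem walkAbsMean_two_mul (m : ℕ) :
    walkAbsMean (2 * m) = 2 * m * (m.centralBinom / 4 ^ m) := by
  induction m with
  | zero => simp [walkAbsMean, walkMean]
  | succ m ih =>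
    have hodd : walkHitZero (2 * m + 1) 0 = 0 := walkHitZero_of_odd ⟨m, by push_cast; ring⟩
    have hc : ((m : ℝ) + 1) * (m + 1).centralBinom = 2 * (2 * m + 1) * m.centralBinom := by
      exact_mod_cast Nat.succ_mul_centralBinom_succ m
    rw [show 2 * (m + 1) = 2 * m + 1 + 1 by ring, walkAbsMean_succ, walkAbsMean_succ, hodd, ih,
      walkHitZero_two_mul, pow_succ]
    push_cast
    field_simp
    linear_combination (-2 : ℝ) * hc

theorem walkAbsMean_eq (n : ℕ) :
    walkAbsMean n = n * ((n / 2).centralBinom / 4 ^ (n / 2)) := by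
  rcases Nat.even_or_odd' n with ⟨m, rfl | rfl⟩
  · rw [walkAbsMean_two_mul, Nat.mul_div_cancel_left _ two_pos]
    push_cast
    ring
  · rw [walkAbsMean_succ, walkAbsMean_two_mul, walkHitZero_two_mul,
      show (2 * m + 1) / 2 = m by omega]
    push_cast
    ring

/-- The product of `(2m+1) W m` and the square of the left side does not depend on `m`, by the
recurrences for both factors. -/
theorem centralBinom_div_four_pow_eq (m : ℕ) :
    (m.centralBinom / 4 ^ m : ℝ) = √(1 / ((2 * m + 1) * Real.Wallis.W m)) := by
  rw [eq_comm, Real.sqrt_eq_iff_eq_sq (by have := Real.Wallis.W_pos m; positivity) (by positivity),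
    eq_comm, eq_div_iff (by have := Real.Wallis.W_pos m; positivity)]
  induction m with
  | zero => simp [Real.Wallis.W]
  | succ m ih =>
    have hc : ((m + 1).centralBinom : ℝ) = 2 * (2 * m + 1) * m.centralBinom / (m + 1) := by
      rw [eq_div_iff (by positivity), mul_comm]
      exact_mod_cast Nat.succ_mul_centralBinom_succ m
    refine Eq.trans ?_ ih
    rw [Real.Wallis.W_succ, hc, pow_succ]
    push_cast
    field_simp
    ring

theorem tendsto_walkAbsMean_div_sqrt :
    Tendsto (fun n : ℕ => walkAbsMean n / √n) atTop (nhds √(2 / Real.pi)) := by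
  have h1 : Tendsto (fun n : ℕ => (n : ℝ) / (2 * (n / 2 : ℕ) + 1)) atTop (nhds 1) := by
    have hl : Tendsto (fun n : ℕ => 1 - 1 / ((n : ℝ) + 1)) atTop (nhds 1) := by
      simpa using tendsto_one_div_add_atTop_nhds_zero_nat.const_sub (1 : ℝ)
    refine tendsto_of_tendsto_of_tendsto_of_le_of_le hl tendsto_const_nhds (fun n => ?_)
      fun n => ?_
    · have : 2 * ((n / 2 : ℕ) : ℝ) + 1 ≤ n + 1 := by
        have : 2 * (n / 2) + 1 ≤ n + 1 := by omega
        exact_mod_cast this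
      have h2 : (1 : ℝ) - 1 / ((n : ℝ) + 1) = n / (n + 1) := by field_simp; ring
      change 1 - 1 / ((n : ℝ) + 1) ≤ _
      rw [h2]
      gcongr
    · have : (n : ℝ) ≤ 2 * ((n / 2 : ℕ) : ℝ) + 1 := by
        have : n ≤ 2 * (n / 2) + 1 := by omega
        exact_mod_cast this
      exact div_le_one_of_le₀ this (by positivity)
  have hhalf : Tendsto (fun n : ℕ => n / 2) atTop atTop :=
    Nat.tendsto_div_const_atTop two_ne_zero
  have h2 := Real.Wallis.tendsto_W_nhds_pi_div_two.comp hhalf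
  have h3 := (h1.div h2 (by positivity)).sqrt
  rw [show (1 : ℝ) / (Real.pi / 2) = 2 / Real.pi by rw [one_div_div]] at h3
  refine h3.congr' ?_
  filter_upwards [eventually_gt_atTop 0] with n hn
  have hn' : (0 : ℝ) < n := by exact_mod_cast hn
  have hW := Real.Wallis.W_pos (n / 2)
  rw [walkAbsMean_eq, centralBinom_div_four_pow_eq, mul_div_right_comm, Real.div_sqrt,
    ← Real.sqrt_mul hn'.le]
  congr 1
  simp only [Pi.div_apply, Function.comp]
  field_simp

end AbsoluteMean

/-! ### The floor sum and Leibniz's series -/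

section FloorSum

/-- The number of `h ≥ 1` for which the square wave of half-period `2 * h + 1` is `-1` at `w`,
written as an alternating sum. -/
noncomputable def floorSum (w : ℕ) : ℝ :=
  ∑ j ∈ Finset.range w, (-1) ^ j * (((w - 1 - j) / (2 * j + 1) : ℕ) : ℝ)

theorem one_sub_neg_one_pow (m : ℕ) :
    (1 : ℝ) - (-1) ^ m = 2 * ∑ j ∈ Finset.range m, (-1) ^ j := by
  induction m with
  | zero => simp
  | succ m ih => rw [Finset.sum_range_succ, mul_add, ← ih, pow_succ]; ring

/-- Write `1 - (-1)^m` as an alternating sum over `j < m` with `m = ⌊(w+h)/(2h+1)⌋`, `h ≥ 1`, and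
exchange sums: `j < m` means `h(2j+1) ≤ w-1-j`, so each `j` counts `⌊(w-1-j)/(2j+1)⌋` values of `h`.
-/
theorem sum_one_sub_squareWave {w N : ℕ} (hN : w ≤ N) :
    ∑ h ∈ Finset.range N, (1 - squareWave (h + 1) w) = 2 * floorSum w := by
  have h1 : ∀ h ∈ Finset.range N, 1 - squareWave (h + 1) w = ∑ j ∈ Finset.range w,
      2 * (-1) ^ j * if h < (w - 1 - j) / (2 * j + 1) then 1 else 0 := by
    intro h _
    have hs : squareWave (h + 1) w = (-1) ^ ((w + (h + 1)) / (2 * (h + 1) + 1)) := by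
      rw [squareWave, ← zpow_natCast]
      congr 1
    have hsub : Finset.range ((w + (h + 1)) / (2 * (h + 1) + 1)) =
        (Finset.range w).filter fun j => h < (w - 1 - j) / (2 * j + 1) := by
      ext j
      rw [Finset.mem_filter, Finset.mem_range, Finset.mem_range, ← Nat.succ_le_iff,
        Nat.le_div_iff_mul_le (by omega), ← Nat.succ_le_iff (m := h),
        Nat.le_div_iff_mul_le (by omega), Nat.succ_eq_add_one, Nat.succ_eq_add_one]
      have e1 : (j + 1) * (2 * (h + 1) + 1) = (h + 1) * (2 * j + 1) + j + 1 + (h + 1) := by ring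
      have e2 : 1 ≤ (h + 1) * (2 * j + 1) := Nat.one_le_iff_ne_zero.2 (by positivity)
      rw [e1]
      omega
    rw [hs, one_sub_neg_one_pow, hsub, Finset.sum_filter, Finset.mul_sum]
    refine Finset.sum_congr rfl fun j _ => ?_
    split_ifs <;> ring
  rw [Finset.sum_congr rfl h1, Finset.sum_comm, floorSum, Finset.mul_sum]
  refine Finset.sum_congr rfl fun j _ => ?_
  have hle : (w - 1 - j) / (2 * j + 1) ≤ N :=
    (Nat.div_le_self _ _).trans (by omega)
  have hf : (Finset.range N).filter (· < (w - 1 - j) / (2 * j + 1)) =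
      Finset.range ((w - 1 - j) / (2 * j + 1)) := by
    ext k; simp; omega
  rw [← Finset.mul_sum, ← Finset.sum_filter, hf]
  simp [mul_assoc]

theorem abs_floorSum_sub_le (w J : ℕ) :
    |floorSum w - ∑ j ∈ Finset.range J, (-1) ^ j * (((w - 1 - j) / (2 * j + 1) : ℕ) : ℝ)| ≤
      w / (2 * J + 1) := by
  set a : ℕ → ℝ := fun j => (((w - 1 - j) / (2 * j + 1) : ℕ) : ℝ) with ha
  have hanti : Antitone a := by
    intro i j hij
    simp only [ha, Nat.cast_le]
    exact (Nat.div_le_div_right (by omega)).trans (Nat.div_le_div_left (by omega) (by omega))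
  have hzero : ∀ j ∉ Finset.range w, a j = 0 := by
    intro j hj
    rw [Finset.mem_range] at hj
    simp [ha, show w - 1 - j = 0 by omega]
  have hb := alternating_series_error_bound a hanti (summable_of_ne_finset_zero hzero) J
  rw [tsum_eq_sum (s := Finset.range w) fun j hj => by rw [hzero j hj, mul_zero]] at hb
  refine hb.trans (Nat.cast_div_le.trans ?_)
  push_cast
  gcongr
  omega

theorem abs_floor_sub_le (w j : ℕ) :
    |(((w - 1 - j) / (2 * j + 1) : ℕ) : ℝ) - w / (2 * j + 1)| ≤ j + 2 := by
  have hp : (0 : ℝ) < 2 * j + 1 := by positivity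
  have h1 : (((w - 1 - j) / (2 * j + 1) : ℕ) : ℝ) ≤ w / (2 * j + 1) := by
    refine Nat.cast_div_le.trans ?_
    push_cast
    gcongr
    omega
  have h2 : w ≤ (2 * j + 1) * ((w - 1 - j) / (2 * j + 1) + 1) + (j + 1) := by
    have := Nat.lt_mul_div_succ (w - 1 - j) (b := 2 * j + 1) (by omega)
    omega
  have h3 : (w : ℝ) ≤ (2 * j + 1) * ((((w - 1 - j) / (2 * j + 1) : ℕ) : ℝ) + 1) + (j + 1) := by
    exact_mod_cast h2
  have h4 : (w : ℝ) / (2 * j + 1) ≤ (((w - 1 - j) / (2 * j + 1) : ℕ) : ℝ) + (j + 2) := by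
    rw [div_le_iff₀ hp]
    nlinarith [(Nat.cast_nonneg j : (0 : ℝ) ≤ j)]
  rw [abs_le]
  constructor <;> linarith [(Nat.cast_nonneg j : (0 : ℝ) ≤ j)]

/-- Truncate at a `J` depending only on `ε`: the tails of the floor sum and of Leibniz's series cost
`ε/2 · w` each, and dropping the first `J` floors costs a constant. -/
theorem exists_abs_floorSum_sub_le {ε : ℝ} (hε : 0 < ε) :
    ∃ C, ∀ w : ℕ, |floorSum w - Real.pi / 4 * w| ≤ ε * w + C := by
  have h1 : Tendsto (fun J : ℕ => 1 / (2 * (J : ℝ) + 1)) atTop (nhds 0) := by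
    refine tendsto_const_nhds.div_atTop (tendsto_atTop_add_const_right _ _ ?_)
    exact tendsto_natCast_atTop_atTop.const_mul_atTop two_pos
  have h2 := Real.tendsto_sum_pi_div_four
  obtain ⟨J, hJ1, hJ2⟩ := ((h1.eventually (gt_mem_nhds (half_pos hε))).and
    (Metric.tendsto_nhds.1 h2 _ (half_pos hε))).exists
  rw [Real.dist_eq] at hJ2
  refine ⟨∑ j ∈ Finset.range J, ((j : ℝ) + 2), fun w => ?_⟩
  have hw : (0 : ℝ) ≤ w := Nat.cast_nonneg w
  set A := ∑ j ∈ Finset.range J, (-1) ^ j * (((w - 1 - j) / (2 * j + 1) : ℕ) : ℝ) with hA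
  set B := ∑ j ∈ Finset.range J, (-1 : ℝ) ^ j / (2 * j + 1) with hB
  have e1 : |floorSum w - A| ≤ ε / 2 * w := by
    refine (abs_floorSum_sub_le w J).trans ?_
    rw [div_eq_mul_one_div, mul_comm]
    gcongr
  have e2 : |A - B * w| ≤ ∑ j ∈ Finset.range J, ((j : ℝ) + 2) := by
    rw [hA, hB, Finset.sum_mul, ← Finset.sum_sub_distrib]
    refine (Finset.abs_sum_le_sum_abs _ _).trans (Finset.sum_le_sum fun j _ => ?_)
    refine le_trans (le_of_eq ?_) (abs_floor_sub_le w j)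
    rw [div_mul_eq_mul_div, mul_div_assoc, ← mul_sub, abs_mul, abs_pow, abs_neg, abs_one, one_pow,
      one_mul]
  have e3 : |B * w - Real.pi / 4 * w| ≤ ε / 2 * w := by
    rw [← sub_mul, abs_mul, abs_of_nonneg hw]
    gcongr
  calc |floorSum w - Real.pi / 4 * w|
      = |(floorSum w - A) + (A - B * w) + (B * w - Real.pi / 4 * w)| := by ring_nf
    _ ≤ |floorSum w - A| + |A - B * w| + |B * w - Real.pi / 4 * w| := abs_add_three _ _ _
    _ ≤ _ := by linarith

/-- The mean of `floorSum |W n|` for the simple random walk `W` on `ℤ` started at `0`. -/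
noncomputable def floorSumMean (n : ℕ) : ℝ := walkMean n (fun w => floorSum w.natAbs) 0

theorem sum_one_sub_walkMean_squareWave {n N : ℕ} (hN : n ≤ N) :
    ∑ h ∈ Finset.range N, (1 - walkMean n (squareWave (h + 1)) 0) = 2 * floorSumMean n := by
  have h1 : ∀ h, 1 - walkMean n (squareWave (h + 1)) 0 =
      walkMean n (fun w => 1 + -1 * squareWave (h + 1) w) 0 := by
    intro h
    rw [walkMean_add, walkMean_const, walkMean_const_mul]
    ring
  simp only [h1]
  rw [← walkMean_sum, floorSumMean, ← walkMean_const_mul]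
  refine walkMean_congr n 0 fun w hw => ?_
  have hw' : w.natAbs ≤ N := by
    rw [sub_zero, abs_le] at hw
    omega
  rw [← sum_one_sub_squareWave hw']
  refine Finset.sum_congr rfl fun h _ => ?_
  have : squareWave (h + 1) w = squareWave (h + 1) w.natAbs := by
    rcases Int.natAbs_eq w with hw | hw
    · rw [← hw]
    · rw [← squareWave_neg, show -w = w.natAbs by omega]
  rw [this]
  ring

/-- By evenness, the evolved wave at 1 at time `n` equals its value at 0 at time `n + 1`. -/
theorem sum_one_sub_survival {n N : ℕ} (hN : n + 1 ≤ N) :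
    ∑ h ∈ Finset.range N, (1 - survival (h + 1) n 0) = floorSumMean n + floorSumMean (n + 1) := by
  have h1 : ∀ h, 1 - survival (h + 1) n 0 = (1 - walkMean n (squareWave (h + 1)) 0) / 2 +
      (1 - walkMean (n + 1) (squareWave (h + 1)) 0) / 2 := by
    intro h
    rw [survival, walkMean, zero_sub,
      walkMean_neg (squareWave_neg (h + 1))]
    ring_nf
  simp only [h1]
  rw [Finset.sum_add_distrib, ← Finset.sum_div, ← Finset.sum_div,
    sum_one_sub_walkMean_squareWave (by omega : n ≤ N), sum_one_sub_walkMean_squareWave hN]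
  ring

theorem exists_abs_floorSumMean_sub_le {ε : ℝ} (hε : 0 < ε) :
    ∃ C, ∀ n, |floorSumMean n - Real.pi / 4 * walkAbsMean n| ≤ ε * walkAbsMean n + C := by
  obtain ⟨C, hC⟩ := exists_abs_floorSum_sub_le hε
  refine ⟨C, fun n => ?_⟩
  have hC' : ∀ w : ℤ, |floorSum w.natAbs - Real.pi / 4 * abs (w : ℝ)| ≤ ε * abs (w : ℝ) + C := by
    intro w
    have := hC w.natAbs
    rwa [Nat.cast_natAbs, Int.cast_abs] at this
  have hup : floorSumMean n ≤ (Real.pi / 4 + ε) * walkAbsMean n + C := by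
    rw [walkAbsMean, ← walkMean_const_mul, ← walkMean_const C n 0, ← walkMean_add]
    exact walkMean_mono n 0 fun w _ => by linarith [(abs_le.1 (hC' w)).2]
  have hlow : (Real.pi / 4 - ε) * walkAbsMean n + -C ≤ floorSumMean n := by
    rw [walkAbsMean, ← walkMean_const_mul, ← walkMean_const (-C) n 0, ← walkMean_add]
    exact walkMean_mono n 0 fun w _ => by linarith [(abs_le.1 (hC' w)).1]
  rw [abs_le]
  constructor <;> linarith

end FloorSum

/-! ### Asymptotics and conclusion -/

theorem isEquivalent_walkAbsMean :
    walkAbsMean ~[atTop] fun n : ℕ => √(2 / Real.pi) * √n := by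
  refine isEquivalent_of_tendsto_one ?_
  have hpos : 0 < √(2 / Real.pi) := Real.sqrt_pos.2 (by positivity)
  have := tendsto_walkAbsMean_div_sqrt.div_const √(2 / Real.pi)
  rw [div_self hpos.ne'] at this
  refine this.congr fun n => ?_
  rw [Pi.div_apply, div_div, mul_comm]

theorem tendsto_walkAbsMean_atTop : Tendsto walkAbsMean atTop atTop := by
  refine isEquivalent_walkAbsMean.symm.tendsto_atTop ?_
  refine Tendsto.const_mul_atTop (Real.sqrt_pos.2 (by positivity)) ?_
  exact Real.tendsto_sqrt_atTop.comp tendsto_natCast_atTop_atTop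

theorem isEquivalent_floorSumMean_add :
    (fun n => floorSumMean n + floorSumMean (n + 1)) ~[atTop]
      fun n : ℕ => √(Real.pi / 2) * (n : ℝ) ^ (1 / 2 : ℝ) := by
  have h1 : (fun n => floorSumMean n + floorSumMean (n + 1)) ~[atTop]
      fun n => Real.pi / 2 * walkAbsMean n := by
    rw [IsEquivalent, isLittleO_const_mul_right_iff (by positivity), isLittleO_iff]
    intro c hc
    obtain ⟨C, hC⟩ := exists_abs_floorSumMean_sub_le (ε := c / 4) (by positivity)
    -- The errors at `n` and `n + 1` add up to `c/2 · walkAbsMean n` plus at most `2C + c/4 + π/4`,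
    -- the last two terms coming from the increment `walkHitZero n 0 ≤ 1`; the threshold absorbs
    -- this constant into the other `c/2`.
    filter_upwards [tendsto_walkAbsMean_atTop.eventually_ge_atTop 0,
      tendsto_walkAbsMean_atTop.eventually_ge_atTop (2 / c * (2 * C + c / 4 + Real.pi / 4))]
      with n hn hn'
    have a1 := abs_le.1 (hC n)
    have a2 := abs_le.1 (hC (n + 1))
    rw [walkAbsMean_succ] at a2
    obtain ⟨b0, b1⟩ := walkHitZero_mem_Icc n
    have a3 : 2 * C + c / 4 + Real.pi / 4 ≤ c / 2 * walkAbsMean n := by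
      calc 2 * C + c / 4 + Real.pi / 4
          = c / 2 * (2 / c * (2 * C + c / 4 + Real.pi / 4)) := by field_simp
        _ ≤ _ := by gcongr
    have a4 := mul_nonneg hc.le b0
    have a5 := mul_le_of_le_one_right hc.le b1
    have a6 := mul_nonneg Real.pi_pos.le b0
    have a7 := mul_le_of_le_one_right Real.pi_pos.le b1
    rw [Real.norm_eq_abs, Real.norm_of_nonneg hn, Pi.sub_apply, abs_le]
    constructor <;> nlinarith
  have h2 : (fun n : ℕ => √(Real.pi / 2) * (n : ℝ) ^ (1 / 2 : ℝ)) =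
      fun n : ℕ => Real.pi / 2 * (√(2 / Real.pi) * √n) := by
    funext n
    rw [← Real.sqrt_eq_rpow, ← mul_assoc]
    congr 1
    have : Real.pi / 2 = √(Real.pi / 2) * √(Real.pi / 2) :=
      (Real.mul_self_sqrt (by positivity)).symm
    rw [← inv_div Real.pi 2, Real.sqrt_inv]
    nth_rewrite 2 [this]
    rw [mul_assoc, mul_inv_cancel₀ (Real.sqrt_ne_zero'.2 (by positivity)), mul_one]
  rw [h2]
  exact h1.trans (IsEquivalent.refl.mul isEquivalent_walkAbsMean)

theorem mainTheorem3 {Ω : Type*} [MeasurableSpace Ω] (μ : Measure Ω) [IsProbabilityMeasure μ]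
    (S : ℕ → Ω → ℤ × ℤ) (hS : IsSimpleRandomWalk combGraph (0, 0) μ S) :
    (∀ n : ℕ, Integrable (fun ω => (maxVerticalDeviation S n ω : ℝ)) μ) ∧
    ((fun n : ℕ => ∫ ω, (maxVerticalDeviation S n ω : ℝ) ∂μ) ~[atTop]
      (fun n : ℕ => Real.sqrt (Real.pi / 2) * (n : ℝ) ^ (1 / 2 : ℝ))) ∧
    (∀ z v : ℂ, ‖z‖ < 1 → 1 + v ^ 2 ≠ 0 → v / (1 + v ^ 2) = z / 2 →
      Summable (fun h : ℕ => v ^ (h + 1) / (1 + v ^ (2 * (h + 1) + 1))) ∧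
      HasSum (fun n : ℕ => ((∫ ω, (maxVerticalDeviation S n ω : ℝ) ∂μ : ℝ) : ℂ) * z ^ n)
        ((1 + v ^ 2) * (1 + v) / (1 - v) ^ 2 *
          ∑' h : ℕ, v ^ (h + 1) / (1 + v ^ (2 * (h + 1) + 1)))) ∧
    (∀ (i : ℕ) (z v : ℂ), 1 + v ^ 2 ≠ 0 → v ^ 2 ≠ 1 → v / (1 + v ^ 2) = z / 2 →
      (tridiagMatrix i (z / 2)).det =
        (1 - v ^ (2 * i + 4)) / ((1 - v ^ 2) * (1 + v ^ 2) ^ (i + 1))) := by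
  refine ⟨integrable_maxVerticalDeviation hS, ?_, fun z v hz hv hzv => ?_,
    fun i z v hv hv2 hzv => tridiagMatrix_det hv hv2 hzv i⟩
  · have : (fun n : ℕ => ∫ ω, (maxVerticalDeviation S n ω : ℝ) ∂μ) =
        fun n => floorSumMean n + floorSumMean (n + 1) := by
      funext n
      rw [integral_maxVerticalDeviation hS n.le_succ, sum_one_sub_survival le_rfl]
    rw [this]
    exact isEquivalent_floorSumMean_add
  · exact hasSum_deviation hz hv hzv fun n => integral_maxVerticalDeviation hS le_rfl
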